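/- Let $\Lambda=[\lambda_1,\dots,\lambda_N]$ be a non-ordered vector (a multiset) of $N\ge 1$ real numbers, and let $Q_N=Q_N[\Lambda]:\mathbb{R}\to\mathbb{R}$ be the associated $TB$-spline, i.e. the compactly supported function with Fourier transform $$\widehat{Q_N}(\xi)=\int_{\mathbb{R}}Q_N(t)e^{-i\xi t}\,dt=\frac{\prod_{j=1}^{N}\left(e^{-\lambda_j}-e^{-i\xi}\right)}{\prod_{j=1}^{N}\left(i\xi-\lambda_j\right)}$$ (extended by continuity at a zero of the denominator), taken continuous if $N\ge2$, and equal to $e^{\lambda_1(t-1)}$ on $[0,1)$ and to $0$ elsewhere if $N=1$. Explicitly, $Q_N[\Lambda]$ is the convolution $Q_1[\lambda_1]*\cdots*Q_1[\lambda_N]$; it vanishes outside $[0,N]$ and is positive on $(0,N)$. Put $\phi=Q_N[\Lambda]$ and $$\phi^{*}(\xi)=\sum_{j\in\mathbb{Z}}\phi(j)e^{-i\xi j},\qquad \Phi_{N-1}[\Lambda](x,\lambda)=\sum_{j\in\mathbb{Z}}\lambda^{j}Q_N[\Lambda](x-j)\quad(\lambda\in\mathbb{C}\setminus\{0\}).$$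 1. For every $\xi\in\mathbb{R}$ the series for $\phi^{*}(\xi)$ and for $\Phi_{N-1}[\Lambda](0,e^{i\xi})$ converge absolutely, and $$\phi^{*}(\xi)=\Phi_{N-1}[\Lambda]\left(0,e^{i\xi}\right).$$ Hence the non-zero condition "$\phi^{*}(\xi)\neq0$ for all $\xi\in\mathbb{R}$" is equivalent to "$\Phi_{N-1}[\Lambda](0,\lambda)\neq0$ for all $\lambda\in\mathbb{C}$ with $|\lambda|=1$". 2. If $\Lambda$ has an even number $N=2p$, $p\ge1$, of entries and is symmetric, i.e. $\Lambda=-\Lambda$ counting multiplicities, then $\phi^{*}(\xi)\neq0$ for all $\xi\in\mathbb{R}$. -/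

import Mathlib

open MeasureTheory Set

namespace ExpSpline

/-- The `TB`-spline of order one for `[a]`: the function `e ^ (a (t - 1))` on `[0, 1)`, and `0`
elsewhere. -/
noncomputable def expPiece (a : ℝ) : ℝ → ℝ :=
  (Ico (0 : ℝ) 1).indicator fun t => Real.exp (a * (t - 1))

/-- The `TB`-spline of a list `[λ₁, …, λ_N]`, `N ≥ 1`: the iterated convolution of the order-one
splines of the `λ_j`. The empty list has no `TB`-spline; the value `0` there is a convention. -/
noncomputable def tbSplineList : List ℝ → ℝ → ℝ
  | [] => fun _ => 0
  | [a] => expPiece a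
  | a :: b :: L => fun t => ∫ s, expPiece a s * tbSplineList (b :: L) (t - s)

theorem expPiece_nonneg (a t : ℝ) : 0 ≤ expPiece a t :=
  indicator_nonneg (fun _ _ => (Real.exp_pos _).le) t

theorem expPiece_measurable (a : ℝ) : Measurable (expPiece a) :=
  Measurable.indicator (by fun_prop) measurableSet_Ico

theorem expPiece_integrable (a : ℝ) : Integrable (expPiece a) := by
  unfold expPiece
  rw [integrable_indicator_iff measurableSet_Ico]
  exact (Continuous.integrableOn_Icc (by fun_prop)).mono_set Ico_subset_Icc_self

theorem expPiece_bdd (a : ℝ) : ∃ C, ∀ t, |expPiece a t| ≤ C := by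
  refine ⟨Real.exp |a|, fun t => ?_⟩
  rw [abs_of_nonneg (expPiece_nonneg a t)]
  unfold expPiece
  refine indicator_le' (fun t ht => ?_) (fun _ _ => (Real.exp_pos _).le) t
  apply Real.exp_le_exp.mpr
  refine (le_abs_self _).trans ?_
  rw [abs_mul]
  have h : |t - 1| ≤ 1 := by
    rw [abs_le]; constructor <;> linarith [ht.1, ht.2]
  nlinarith [abs_nonneg a]

theorem expPiece_continuousAt (a : ℝ) {t : ℝ} (h0 : t ≠ 0) (h1 : t ≠ 1) :
    ContinuousAt (expPiece a) t := by
  have h : t ∉ frontier (Ico (0 : ℝ) 1) := by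
    rw [frontier_Ico (by norm_num)]
    simp [h0, h1]
  unfold expPiece
  exact (show Continuous fun t => Real.exp (a * (t - 1)) by fun_prop).continuousOn
    |>.continuousAt_indicator h

theorem tbSplineList_measurable (L : List ℝ) : Measurable (tbSplineList L) := by
  match L with
  | [] => exact measurable_const
  | [a] => exact expPiece_measurable a
  | a :: b :: L =>
    have ih := tbSplineList_measurable (b :: L)
    have h : StronglyMeasurable
        (Function.uncurry fun t s : ℝ => expPiece a s * tbSplineList (b :: L) (t - s)) := by
      apply Measurable.stronglyMeasurable
      exact ((expPiece_measurable a).comp measurable_snd).mul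
        (ih.comp (measurable_fst.sub measurable_snd))
    exact h.integral_prod_right.measurable

theorem tbSplineList_nonneg (L : List ℝ) (t : ℝ) : 0 ≤ tbSplineList L t := by
  match L with
  | [] => exact le_rfl
  | [a] => exact expPiece_nonneg a t
  | a :: b :: L =>
    exact integral_nonneg fun s =>
      mul_nonneg (expPiece_nonneg a s) (tbSplineList_nonneg (b :: L) _)

theorem tbSplineList_bdd (L : List ℝ) : ∃ C, ∀ t, |tbSplineList L t| ≤ C := by
  match L with
  | [] => exact ⟨0, fun t => by simp [tbSplineList]⟩
  | [a] => exact expPiece_bdd a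
  | a :: b :: L =>
    obtain ⟨C, hC⟩ := tbSplineList_bdd (b :: L)
    refine ⟨∫ s, expPiece a s * C, fun t => ?_⟩
    rw [← Real.norm_eq_abs]
    refine norm_integral_le_of_norm_le ((expPiece_integrable a).mul_const C) ?_
    refine Filter.Eventually.of_forall fun s => ?_
    rw [norm_mul, Real.norm_of_nonneg (expPiece_nonneg a s)]
    exact mul_le_mul_of_nonneg_left (hC _) (expPiece_nonneg a s)

/-- The spline of order `N` vanishes outside `[0, N]`. -/
theorem tbSplineList_eq_zero (L : List ℝ) {t : ℝ} (ht : t ∉ Icc (0 : ℝ) L.length) :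
    tbSplineList L t = 0 := by
  match L with
  | [] => rfl
  | [a] =>
    have h : t ∉ Ico (0 : ℝ) 1 := fun h => ht (by simpa using Ico_subset_Icc_self h)
    simp only [tbSplineList, expPiece, indicator_of_notMem h]
  | a :: b :: L =>
    have h : ∀ s, expPiece a s * tbSplineList (b :: L) (t - s) = 0 := by
      intro s
      by_cases hs : s ∈ Ico (0 : ℝ) 1
      · have : t - s ∉ Icc (0 : ℝ) (b :: L).length := by
          intro h
          apply ht
          have h1 := h.1
          have h2 := h.2
          have h3 := hs.1
          have h4 := hs.2
          simp only [List.length_cons, Nat.cast_add, Nat.cast_one] at h2 ⊢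
          constructor <;> linarith
        rw [tbSplineList_eq_zero (b :: L) this, mul_zero]
      · rw [show expPiece a s = 0 from indicator_of_notMem hs _, zero_mul]
    simp only [tbSplineList, h, integral_zero]

theorem tbSplineList_integrable (L : List ℝ) : Integrable (tbSplineList L) := by
  obtain ⟨C, hC⟩ := tbSplineList_bdd L
  have h : IntegrableOn (tbSplineList L) (Icc (0 : ℝ) L.length) := by
    refine Measure.integrableOn_of_bounded (M := C) (by simp)
      (tbSplineList_measurable L).aestronglyMeasurable ?_
    exact Filter.Eventually.of_forall hC
  exact h.integrable_of_forall_notMem_eq_zero fun t ht => tbSplineList_eq_zero L ht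

theorem integrable_conv_integrand (a : ℝ) (L : List ℝ) (t : ℝ) :
    Integrable fun s => expPiece a s * tbSplineList L (t - s) := by
  obtain ⟨C, hC⟩ := tbSplineList_bdd L
  refine (expPiece_integrable a).mul_bdd (c := C) ?_ (Filter.Eventually.of_forall fun s => hC _)
  exact ((tbSplineList_measurable L).comp (measurable_const.sub measurable_id)).aestronglyMeasurable

/-- The spline of order `N` is positive on `(0, N)`. -/
theorem tbSplineList_pos (L : List ℝ) {t : ℝ} (ht : t ∈ Ioo (0 : ℝ) L.length) :
    0 < tbSplineList L t := by
  match L with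
  | [] => simp at ht
  | [a] =>
    rw [tbSplineList, expPiece, indicator_of_mem]
    · exact Real.exp_pos _
    · simpa using Ioo_subset_Ico_self ht
  | a :: b :: L =>
    rw [tbSplineList]
    rw [integral_pos_iff_support_of_nonneg
      (fun s => mul_nonneg (expPiece_nonneg a s) (tbSplineList_nonneg _ _))
      (integrable_conv_integrand a _ t)]
    have h0 := ht.1
    have h1 := ht.2
    simp only [List.length_cons, Nat.cast_add, Nat.cast_one] at h1
    have hn : (0 : ℝ) ≤ L.length := Nat.cast_nonneg _
    refine lt_of_lt_of_le (b := volume (Ioo (max 0 (t - (L.length + 1))) (min 1 t))) ?_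
      (measure_mono ?_)
    · rw [Real.volume_Ioo, ENNReal.ofReal_pos, sub_pos]
      apply max_lt <;> apply lt_min <;> linarith
    · intro s hs
      have h2 := max_lt_iff.mp hs.1
      have h3 := lt_min_iff.mp hs.2
      refine ne_of_gt (mul_pos ?_ (tbSplineList_pos (b :: L) ⟨by linarith, ?_⟩))
      · rw [expPiece, indicator_of_mem (show s ∈ Ico (0 : ℝ) 1 from ⟨h2.1.le, h3.1⟩)]
        exact Real.exp_pos _
      · simp only [List.length_cons, Nat.cast_add, Nat.cast_one]
        linarith [h2.2]

theorem tbSplineList_continuousAt (L : List ℝ) {t : ℝ} (h0 : t ≠ 0 ∨ 2 ≤ L.length)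
    (h1 : t ≠ 1 ∨ 2 ≤ L.length) : ContinuousAt (tbSplineList L) t := by
  match L with
  | [] => exact continuousAt_const
  | [a] =>
    have h2 : ¬ 2 ≤ [a].length := by simp
    exact expPiece_continuousAt a (h0.resolve_right h2) (h1.resolve_right h2)
  | a :: b :: L =>
    obtain ⟨C, hC⟩ := tbSplineList_bdd (b :: L)
    rw [show tbSplineList (a :: b :: L)
      = fun t => ∫ s, expPiece a s * tbSplineList (b :: L) (t - s) from rfl]
    refine continuousAt_of_dominated (bound := fun s => expPiece a s * C)
      (Filter.Eventually.of_forall fun u =>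
        (integrable_conv_integrand a (b :: L) u).aestronglyMeasurable)
      (Filter.Eventually.of_forall fun u => Filter.Eventually.of_forall fun s => ?_)
      ((expPiece_integrable a).mul_const C) ?_
    · rw [norm_mul, Real.norm_of_nonneg (expPiece_nonneg a s)]
      exact mul_le_mul_of_nonneg_left (hC _) (expPiece_nonneg a s)
    · filter_upwards [compl_mem_ae_iff.mpr (measure_singleton (μ := volume) t),
        compl_mem_ae_iff.mpr (measure_singleton (μ := volume) (t - 1))] with s hs0 hs1
      have hs0' : s ≠ t := hs0
      have hs1' : s ≠ t - 1 := hs1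
      refine continuousAt_const.mul ?_
      refine ContinuousAt.comp (g := tbSplineList (b :: L))
        (tbSplineList_continuousAt (b :: L) (Or.inl ?_) (Or.inl ?_)) (by fun_prop)
      · exact fun h => hs0' (by linarith)
      · exact fun h => hs1' (by linarith)

theorem tbSplineList_swap (a b : ℝ) (L : List ℝ) :
    tbSplineList (a :: b :: L) = tbSplineList (b :: a :: L) := by
  funext t
  match L with
  | [] =>
    simp only [tbSplineList]
    rw [← integral_sub_left_eq_self (fun s => expPiece a s * expPiece b (t - s)) volume t]
    refine integral_congr_ae (Filter.Eventually.of_forall fun s => ?_)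
    simp [mul_comm]
  | c :: L =>
    obtain ⟨C, hC⟩ := tbSplineList_bdd (c :: L)
    have hm := tbSplineList_measurable (c :: L)
    simp only [tbSplineList, ← integral_const_mul]
    rw [integral_integral_swap]
    · refine integral_congr_ae (Filter.Eventually.of_forall fun s => ?_)
      refine integral_congr_ae (Filter.Eventually.of_forall fun u => ?_)
      simp only [sub_right_comm t u s]
      ring
    · have h := ((expPiece_integrable a).mul_prod (expPiece_integrable b)).mul_bdd (c := C)
        (g := fun z : ℝ × ℝ => tbSplineList (c :: L) (t - z.1 - z.2))
        (hm.comp (by fun_prop)).aestronglyMeasurable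
        (Filter.Eventually.of_forall fun z => hC _)
      refine h.congr (Filter.Eventually.of_forall fun z => ?_)
      simp [Function.uncurry, mul_assoc]

theorem tbSplineList_perm {L M : List ℝ} (h : L.Perm M) : tbSplineList L = tbSplineList M := by
  induction h with
  | nil => rfl
  | @cons a l₁ l₂ h ih =>
    match l₁, l₂ with
    | [], [] => rfl
    | [], c :: l => simp at h
    | c :: l, [] => simp at h
    | c :: l, d :: l' => simp only [tbSplineList, ih]
  | swap a b l => exact tbSplineList_swap b a l
  | trans _ _ h₁ h₂ => exact h₁.trans h₂

/-- The `TB`-spline `Q_N[Λ]` of the non-ordered real vector `Λ` with `N` entries. -/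
noncomputable def tbSpline (Λ : Multiset ℝ) : ℝ → ℝ :=
  Quot.liftOn Λ tbSplineList fun _ _ h => tbSplineList_perm h

theorem tbSpline_coe (L : List ℝ) : tbSpline (L : Multiset ℝ) = tbSplineList L := rfl

theorem tbSpline_eq_zero (Λ : Multiset ℝ) {t : ℝ} (ht : t ∉ Icc (0 : ℝ) (Multiset.card Λ)) :
    tbSpline Λ t = 0 := by
  induction Λ using Quot.inductionOn with
  | h L => exact tbSplineList_eq_zero L ht

theorem tbSpline_pos (Λ : Multiset ℝ) {t : ℝ} (ht : t ∈ Ioo (0 : ℝ) (Multiset.card Λ)) :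
    0 < tbSpline Λ t := by
  induction Λ using Quot.inductionOn with
  | h L => exact tbSplineList_pos L ht

theorem tbSpline_continuous (Λ : Multiset ℝ) (h : 2 ≤ Multiset.card Λ) :
    Continuous (tbSpline Λ) := by
  induction Λ using Quot.inductionOn with
  | h L =>
    exact continuous_iff_continuousAt.mpr fun _ =>
      tbSplineList_continuousAt L (Or.inr h) (Or.inr h)

theorem tbSpline_integrable (Λ : Multiset ℝ) : Integrable (tbSpline Λ) := by
  induction Λ using Quot.inductionOn with
  | h L => exact tbSplineList_integrable L

/-- The Fourier transform `∫ f(t) e ^ (-i ξ t) dt` of a real function. -/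
noncomputable def fourierTransform (f : ℝ → ℝ) (ξ : ℝ) : ℂ :=
  ∫ t, (f t : ℂ) * Complex.exp (-(Complex.I * ξ * t))

theorem fourierTransform_integrable {f : ℝ → ℝ} (hf : Integrable f) (ξ : ℝ) :
    Integrable fun t : ℝ => (f t : ℂ) * Complex.exp (-(Complex.I * ξ * t)) := by
  refine hf.ofReal.mul_bdd (c := 1) (Continuous.aestronglyMeasurable (by fun_prop))
    (Filter.Eventually.of_forall fun t => ?_)
  rw [Complex.norm_exp]
  simp

theorem fourierTransform_expPiece (a ξ : ℝ) :
    (Complex.I * ξ - a) * fourierTransform (expPiece a) ξ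
      = Complex.exp (-a) - Complex.exp (-(Complex.I * ξ)) := by
  have h : fourierTransform (expPiece a) ξ
      = ∫ t in (0 : ℝ)..1, Complex.exp (-a) * Complex.exp ((a - Complex.I * ξ) * t) := by
    rw [intervalIntegral.integral_of_le zero_le_one, ← integral_Ico_eq_integral_Ioc,
      ← integral_indicator measurableSet_Ico]
    refine integral_congr_ae (Filter.Eventually.of_forall fun t => ?_)
    by_cases ht : t ∈ Ico (0 : ℝ) 1
    · simp only [expPiece, indicator_of_mem ht, Complex.ofReal_exp, ← Complex.exp_add]
      congr 1
      push_cast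
      ring
    · simp [expPiece, indicator_of_notMem ht]
  rw [h, intervalIntegral.integral_const_mul]
  by_cases hc : (a - Complex.I * ξ : ℂ) = 0
  · have h1 : (Complex.I * ξ : ℂ) = a := (sub_eq_zero.mp hc).symm
    simp [h1]
  · rw [integral_exp_mul_complex hc]
    have h2 : (Complex.I * ξ - a : ℂ) = -(a - Complex.I * ξ) := by ring
    rw [h2]
    field_simp
    have h3 : Complex.exp (-(Complex.I * ξ))
        = Complex.exp (-a) * Complex.exp (a - Complex.I * ξ) := by
      rw [← Complex.exp_add]; congr 1; ring
    rw [h3]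
    simp
    ring

theorem fourierTransform_cons (a b : ℝ) (L : List ℝ) (ξ : ℝ) :
    fourierTransform (tbSplineList (a :: b :: L)) ξ
      = fourierTransform (expPiece a) ξ * fourierTransform (tbSplineList (b :: L)) ξ := by
  have h := integral_convolution (μ := volume) (ν := volume) (ContinuousLinearMap.mul ℝ ℂ)
    (fourierTransform_integrable (expPiece_integrable a) ξ)
    (fourierTransform_integrable (tbSplineList_integrable (b :: L)) ξ)
  rw [ContinuousLinearMap.mul_apply'] at h
  refine Eq.trans ?_ h
  refine integral_congr_ae (Filter.Eventually.of_forall fun t => ?_)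
  simp only [convolution, ContinuousLinearMap.mul_apply', tbSplineList]
  rw [← integral_complex_ofReal, ← integral_mul_const]
  refine integral_congr_ae (Filter.Eventually.of_forall fun s => ?_)
  have h3 : Complex.exp (-(Complex.I * ξ * t))
      = Complex.exp (-(Complex.I * ξ * s)) * Complex.exp (-(Complex.I * ξ * (t - s : ℝ))) := by
    rw [← Complex.exp_add]; congr 1; push_cast; ring
  simp only [h3]
  push_cast
  ring

/-- The Fourier transform of `Q_N[Λ]` is
`∏ (e ^ (-λ_j) - e ^ (-iξ)) / ∏ (iξ - λ_j)`, in a form that needs no division. -/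
theorem fourierTransform_tbSpline (Λ : Multiset ℝ) (hΛ : 1 ≤ Multiset.card Λ) (ξ : ℝ) :
    (Λ.map fun l : ℝ => (Complex.I * ξ - l : ℂ)).prod * fourierTransform (tbSpline Λ) ξ
      = (Λ.map fun l : ℝ => Complex.exp (-l) - Complex.exp (-(Complex.I * ξ))).prod := by
  induction Λ using Quot.inductionOn with
  | h L =>
    change 1 ≤ L.length at hΛ
    change ((L : Multiset ℝ).map _).prod * fourierTransform (tbSplineList L) ξ
      = ((L : Multiset ℝ).map _).prod
    simp only [Multiset.map_coe, Multiset.prod_coe]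
    induction L with
    | nil => simp at hΛ
    | cons a L ih =>
      match L with
      | [] => simpa [tbSplineList] using fourierTransform_expPiece a ξ
      | b :: L =>
        have ih' := ih (by simp)
        rw [fourierTransform_cons, List.map_cons, List.prod_cons, List.map_cons (l := b :: L),
          List.prod_cons, ← ih', ← fourierTransform_expPiece a ξ]
        ring

/-- `φ*(ξ) = ∑_{j ∈ ℤ} φ(j) e ^ (-iξj)`. -/
noncomputable def phiStar (φ : ℝ → ℝ) (ξ : ℝ) : ℂ :=
  ∑' j : ℤ, (φ j : ℂ) * Complex.exp (-(Complex.I * ξ * j))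

/-- The Euler–Schoenberg exponential spline
`Φ_{N-1}[Λ](x; z) = ∑_{j ∈ ℤ} z ^ j Q_N[Λ](x - j)`, where `N` is the number of entries of `Λ`
and `z ≠ 0`. -/
noncomputable def eulerSchoenberg (Λ : Multiset ℝ) (x : ℝ) (z : ℂ) : ℂ :=
  ∑' j : ℤ, z ^ j * (tbSpline Λ (x - j) : ℂ)

/-- `Λ` is symmetric: `Λ = -Λ` as a non-ordered vector, counting multiplicities. -/
def IsSymmetric (Λ : Multiset ℝ) : Prop :=
  Λ.map (fun l => -l) = Λ

end ExpSpline

namespace ExpSpline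

/-! Part 1 is the reindexing `j ↦ -j` in a sum that is finite because the spline has compact
support. Part 2 splits a symmetric `Λ` as `A + (-A)` with `p` entries in `A`. Put `f = Q_p[A]`.
Since `Q_p[-A]` is a positive multiple of the reflection of `f`, the values `φ(p - k)` are `c > 0`
times the autocorrelation of `f` at `k`. With `h(t) = f(t) e^{-iξt}` this gives `φ*(ξ) = c e^{-iξp}
∫₀¹ |∑ₗ h(s + l)|² ds` (`sum_autocorrelation_eq`). If this vanishes, the periodization of `h` is
zero almost everywhere, so its integral over a period, which is the Fourier transform of `f` at `ξ`,
is zero. The product formula excludes that unless `e^{-iξ} = 1`; in that case `φ*(ξ) = ∑ φ(j) > 0`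
directly. -/

/-! ### Convolution and reflection of splines -/

/-- Associativity of convolution: induction on `A`, with a translation and Fubini at each step. -/
theorem tbSplineList_append {A B : List ℝ} (hA : A ≠ []) (hB : B ≠ []) (t : ℝ) :
    tbSplineList (A ++ B) t = ∫ u, tbSplineList A u * tbSplineList B (t - u) := by
  induction A generalizing t with
  | nil => exact absurd rfl hA
  | cons a A ih =>
    match A, B with
    | _, [] => exact absurd rfl hB
    | [], b :: B => rfl
    | c :: A, b :: B =>
      obtain ⟨C, hC⟩ := tbSplineList_bdd (c :: A)
      have hm := tbSplineList_measurable (c :: A)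
      calc tbSplineList (a :: c :: A ++ b :: B) t
          = ∫ s, expPiece a s * tbSplineList (c :: A ++ b :: B) (t - s) := rfl
        _ = ∫ s, ∫ v, expPiece a s *
              (tbSplineList (c :: A) (v - s) * tbSplineList (b :: B) (t - v)) := by
            refine integral_congr_ae (Filter.Eventually.of_forall fun s => ?_)
            simp only [ih (by simp), integral_const_mul]
            rw [← integral_sub_right_eq_self
              (fun u => tbSplineList (c :: A) u * tbSplineList (b :: B) (t - s - u)) s]
            simp
        _ = ∫ v, ∫ s, expPiece a s *
              (tbSplineList (c :: A) (v - s) * tbSplineList (b :: B) (t - v)) := by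
            refine integral_integral_swap ?_
            have h := ((expPiece_integrable a).mul_prod
              ((tbSplineList_integrable (b :: B)).comp_sub_left t)).mul_bdd (c := C)
              (g := fun z : ℝ × ℝ => tbSplineList (c :: A) (z.2 - z.1))
              (hm.comp (by fun_prop)).aestronglyMeasurable
              (Filter.Eventually.of_forall fun z => hC _)
            refine h.congr (Filter.Eventually.of_forall fun z => ?_)
            simp only [Function.uncurry]
            ring
        _ = ∫ v, tbSplineList (a :: c :: A) v * tbSplineList (b :: B) (t - v) := by
            refine integral_congr_ae (Filter.Eventually.of_forall fun v => ?_)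
            simp only [← mul_assoc, integral_mul_const]
            rfl

/-- Reflection carries `[0, 1)` to `(0, 1]`, so the identity can fail only at the two endpoints, a
null set for later integrals. -/
theorem expPiece_neg (a : ℝ) {t : ℝ} (h0 : t ≠ 0) (h1 : t ≠ 1) :
    expPiece (-a) t = Real.exp a * expPiece a (1 - t) := by
  unfold expPiece
  by_cases ht : t ∈ Ico (0 : ℝ) 1
  · have ht' : 1 - t ∈ Ico (0 : ℝ) 1 :=
      ⟨by linarith [ht.2], by linarith [lt_of_le_of_ne ht.1 h0.symm]⟩
    rw [indicator_of_mem ht, indicator_of_mem ht', ← Real.exp_add]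
    congr 1
    ring
  · have ht' : 1 - t ∉ Ico (0 : ℝ) 1 := fun h =>
      ht ⟨by linarith [h.2], lt_of_le_of_ne (by linarith [h.1]) h1⟩
    rw [indicator_of_notMem ht, indicator_of_notMem ht', mul_zero]

/-- Negating the entries reflects the spline, up to a positive factor. -/
theorem tbSplineList_map_neg (A : List ℝ) :
    ∃ c > 0, ∀ t : ℝ, t ≠ 0 → t ≠ A.length →
      tbSplineList (A.map fun l => -l) t = c * tbSplineList A (A.length - t) := by
  induction A with
  | nil => exact ⟨1, one_pos, fun t _ _ => by simp [tbSplineList]⟩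
  | cons a A ih =>
    match A with
    | [] =>
      exact ⟨Real.exp a, Real.exp_pos a, fun t h0 h1 => by
        simpa [tbSplineList] using expPiece_neg a h0 (by simpa using h1)⟩
    | b :: A =>
      obtain ⟨c, hc, h⟩ := ih
      refine ⟨Real.exp a * c, by positivity, fun t _ _ => ?_⟩
      have hne : ∀ x : ℝ, ∀ᵐ s : ℝ, s ≠ x := fun x =>
        compl_mem_ae_iff.mpr (measure_singleton x)
      calc tbSplineList ((a :: b :: A).map fun l => -l) t
          = ∫ s, expPiece (-a) s * tbSplineList ((b :: A).map fun l => -l) (t - s) := rfl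
        _ = ∫ s, Real.exp a * c *
              (expPiece a (1 - s) *
                tbSplineList (b :: A) ((a :: b :: A).length - t - (1 - s))) := by
            refine integral_congr_ae ?_
            -- These four values of `s` are where one of the two reflection identities is
            -- unavailable.
            filter_upwards [hne 0, hne 1, hne t, hne (t - (b :: A).length)] with s h0 h1 h2 h3
            rw [expPiece_neg a h0 h1, h (t - s) (fun h => h2 (by linarith))
              (fun h => h3 (by linarith))]
            rw [show (((a :: b :: A).length : ℕ) : ℝ) - t - (1 - s)
              = ((b :: A).length : ℕ) - (t - s) by simp; ring]
            ring
        _ = Real.exp a * c * ∫ s, expPiece a s *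
              tbSplineList (b :: A) ((a :: b :: A).length - t - s) := by
            rw [integral_const_mul, integral_sub_left_eq_self (fun s => expPiece a s *
              tbSplineList (b :: A) ((a :: b :: A).length - t - s)) volume 1]
        _ = _ := rfl

/-! ### Halving a symmetric vector -/

/-- A symmetric vector with evenly many entries consists of a vector and its negative. -/
theorem IsSymmetric.exists_eq_add {Λ : Multiset ℝ} (h : IsSymmetric Λ) {p : ℕ}
    (hp : Multiset.card Λ = 2 * p) :
    ∃ A : Multiset ℝ, Multiset.card A = p ∧ Λ = A + A.map fun l => -l := by
  have hcn : ∀ (M : Multiset ℝ) (x : ℝ), (M.map fun l => -l).count x = M.count (-x) := by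
    intro M x
    conv_lhs => rw [← neg_neg x]
    exact Multiset.count_map_eq_count' _ M neg_injective (-x)
  have hc : ∀ x, Λ.count (-x) = Λ.count x := fun x => by rw [← hcn, h]
  have hneg : (Λ.filter (0 < ·)).map (fun l => -l) = Λ.filter (· < 0) := by
    ext x
    rw [hcn]
    rw [Multiset.count_filter, Multiset.count_filter, hc]
    simp only [neg_pos]
  have hsum : Λ = Λ.filter (0 < ·) + Λ.filter (· < 0) + Multiset.replicate (Λ.count 0) 0 := by
    ext x
    rw [Multiset.count_add, Multiset.count_add, Multiset.count_filter, Multiset.count_filter,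
      Multiset.count_replicate]
    rcases lt_trichotomy x 0 with hx | hx | hx
    · simp [hx, hx.ne', hx.le]
    · simp [hx]
    · simp [hx, hx.ne, hx.le]
  have hcard := congrArg Multiset.card hsum
  rw [← hneg] at hcard
  simp only [Multiset.card_add, Multiset.card_map, Multiset.card_replicate, hp] at hcard
  -- By `hcard` the positive entries, counted twice, and the zeros number `2 * p`; hence the zeros
  -- are even in number and can be shared equally.
  have h2 : Λ = (Λ.filter (0 < ·) + Multiset.replicate (Λ.count 0 / 2) 0)
      + (Λ.filter (0 < ·) + Multiset.replicate (Λ.count 0 / 2) 0).map fun l => -l := by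
    conv_lhs => rw [hsum]
    rw [Multiset.map_add, hneg, Multiset.map_replicate, neg_zero, add_add_add_comm,
      ← Multiset.replicate_add]
    congr 2
    omega
  refine ⟨_, ?_, h2⟩
  have h3 := congrArg Multiset.card h2
  rw [Multiset.card_add, Multiset.card_map, hp] at h3
  omega

/-! ### The series on the unit circle -/

theorem phiStar_tbSpline_summable (Λ : Multiset ℝ) (c : ℤ → ℂ) :
    Summable fun j : ℤ => (tbSpline Λ j : ℂ) * c j := by
  refine summable_of_ne_finset_zero (s := Finset.Icc 0 (Multiset.card Λ : ℤ)) fun j hj => ?_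
  rw [tbSpline_eq_zero Λ, Complex.ofReal_zero, zero_mul]
  rintro ⟨h1, h2⟩
  exact hj (Finset.mem_Icc.mpr ⟨by exact_mod_cast h1, by exact_mod_cast h2⟩)

theorem phiStar_eq_eulerSchoenberg (Λ : Multiset ℝ) (ξ : ℝ) :
    Summable (fun j : ℤ => Complex.exp (Complex.I * ξ) ^ j * (tbSpline Λ (0 - j) : ℂ)) ∧
      phiStar (tbSpline Λ) ξ = eulerSchoenberg Λ 0 (Complex.exp (Complex.I * ξ)) := by
  have h : ∀ j : ℤ, Complex.exp (Complex.I * ξ) ^ j * (tbSpline Λ (0 - j) : ℂ)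
      = (tbSpline Λ ((Equiv.neg ℤ j : ℤ) : ℝ) : ℂ)
        * Complex.exp (-(Complex.I * ξ * (Equiv.neg ℤ j : ℤ))) := by
    intro j
    rw [← Complex.exp_int_mul, mul_comm]
    simp only [Equiv.neg_apply, Int.cast_neg, zero_sub]
    congr 2
    ring
  unfold phiStar eulerSchoenberg
  simp only [h]
  have hs := phiStar_tbSpline_summable Λ fun j => Complex.exp (-(Complex.I * ξ * j))
  exact ⟨hs.comp_injective (Equiv.neg ℤ).injective,
    ((Equiv.neg ℤ).tsum_eq fun j : ℤ =>
      (tbSpline Λ j : ℂ) * Complex.exp (-(Complex.I * ξ * j))).symm⟩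

theorem phiStar_ne_zero_iff (Λ : Multiset ℝ) :
    (∀ ξ : ℝ, phiStar (tbSpline Λ) ξ ≠ 0) ↔
      ∀ z : ℂ, ‖z‖ = 1 → eulerSchoenberg Λ 0 z ≠ 0 := by
  constructor
  · intro h z hz
    obtain ⟨ξ, rfl⟩ := (Complex.norm_eq_one_iff z).mp hz
    rw [mul_comm, ← (phiStar_eq_eulerSchoenberg Λ ξ).2]
    exact h ξ
  · intro h ξ
    rw [(phiStar_eq_eulerSchoenberg Λ ξ).2]
    exact h _ (by rw [mul_comm]; exact Complex.norm_exp_ofReal_mul_I ξ)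

/-! ### Frequencies with `e^{-iξ} = 1`, and the Fourier transform at the others -/

/-- All exponential weights are `1`, leaving a sum of nonnegative numbers whose term at `1`, an
interior point of the support, is positive. -/
theorem phiStar_ne_zero_of_exp_eq_one {Λ : Multiset ℝ} (hΛ : 2 ≤ Multiset.card Λ) {ξ : ℝ}
    (hξ : Complex.exp (-(Complex.I * ξ)) = 1) : phiStar (tbSpline Λ) ξ ≠ 0 := by
  have h : ∀ j : ℤ, (tbSpline Λ j : ℂ) * Complex.exp (-(Complex.I * ξ * j))
      = (tbSpline Λ j : ℂ) := by
    intro j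
    rw [show -(Complex.I * ξ * j) = j * (-(Complex.I * ξ)) by ring, Complex.exp_int_mul, hξ,
      one_zpow, mul_one]
  have hs : Summable fun j : ℤ => tbSpline Λ j := by
    have := phiStar_tbSpline_summable Λ fun _ => 1
    simp only [mul_one] at this
    exact_mod_cast this
  have h0 : ∀ j : ℤ, 0 ≤ tbSpline Λ j := by
    induction Λ using Quot.inductionOn with
    | h L => exact fun j => tbSplineList_nonneg L j
  have h1 : 0 < tbSpline Λ ((1 : ℤ) : ℝ) := by
    refine tbSpline_pos Λ ⟨by norm_num, ?_⟩
    exact_mod_cast hΛ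
  unfold phiStar
  simp only [h]
  rw [← Complex.ofReal_tsum]
  exact_mod_cast (hs.tsum_pos h0 1 h1).ne'

/-- A vanishing factor `e^{-a} - e^{-iξ}` forces `a = 0` by comparing moduli, and then `e^{-iξ} =
1`. -/
theorem fourierTransform_tbSpline_ne_zero {Λ : Multiset ℝ} (hΛ : 1 ≤ Multiset.card Λ) {ξ : ℝ}
    (hξ : Complex.exp (-(Complex.I * ξ)) ≠ 1) : fourierTransform (tbSpline Λ) ξ ≠ 0 := by
  intro h
  have h1 := fourierTransform_tbSpline Λ hΛ ξ
  rw [h, mul_zero, eq_comm, Multiset.prod_eq_zero_iff, Multiset.mem_map] at h1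
  obtain ⟨a, -, ha⟩ := h1
  rw [sub_eq_zero] at ha
  have h2 := congrArg norm ha
  simp only [Complex.norm_exp] at h2
  have h3 : a = 0 := by simpa using h2
  exact hξ (by rw [← ha, h3]; simp)


/-! ### Autocorrelation and periodization -/

theorem integral_eq_integral_periodization {u : ℝ → ℂ} (hu : Integrable u) {p : ℕ}
    (h0 : ∀ t ∉ Icc (0 : ℝ) p, u t = 0) :
    ∫ t, u t = ∫ s in (0 : ℝ)..1, ∑ l ∈ Finset.range p, u (s + l) := by
  rw [intervalIntegral.integral_finsetSum (f := fun (l : ℕ) s => u (s + l))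
      fun l _ => (hu.comp_add_right (l : ℝ)).intervalIntegrable,
    ← setIntegral_eq_integral_of_forall_compl_eq_zero h0, integral_Icc_eq_integral_Ioc,
    ← intervalIntegral.integral_of_le p.cast_nonneg]
  have h := intervalIntegral.sum_integral_adjacent_intervals (f := u) (μ := volume)
    (a := fun k : ℕ => (k : ℝ)) (n := p) fun k _ => hu.intervalIntegrable
  rw [Nat.cast_zero] at h
  rw [← h]
  refine Finset.sum_congr rfl fun l _ => ?_
  rw [intervalIntegral.integral_comp_add_right]
  simp [add_comm]

/-- The sum over all integer shifts of the autocorrelation of a function is the squared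
`L²`-norm of its periodization. -/
theorem sum_autocorrelation_eq {h : ℝ → ℂ} (hm : Measurable h) (hi : Integrable h) {C : ℝ}
    (hC : ∀ t, ‖h t‖ ≤ C) {p : ℕ} (h0 : ∀ t ∉ Icc (0 : ℝ) p, h t = 0) :
    ∑ k ∈ Finset.Icc (-p : ℤ) p, ∫ s, h s * starRingEnd ℂ (h (s + k))
      = ((∫ s in (0 : ℝ)..1, ‖∑ l ∈ Finset.range p, h (s + l)‖ ^ 2 : ℝ) : ℂ) := by
  have hk : ∀ k : ℤ, Integrable fun s => h s * starRingEnd ℂ (h (s + k)) := fun k =>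
    hi.mul_bdd (c := C) (Complex.continuous_conj.measurable.comp
      (hm.comp (by fun_prop))).aestronglyMeasurable
      (Filter.Eventually.of_forall fun s => by simpa using hC _)
  rw [← integral_finsetSum _ fun k _ => hk k,
    integral_eq_integral_periodization (integrable_finsetSum _ fun k _ => hk k)
      (fun t ht => by simp [h0 t ht]), ← intervalIntegral.integral_ofReal]
  refine intervalIntegral.integral_congr_ae ?_
  -- For `0 < s < 1`, only the shifts `0, …, p - 1` can bring `s` into `[0, p]`; at `s = 1` the
  -- shift `-1` could too.
  filter_upwards [compl_mem_ae_iff.mpr (measure_singleton (μ := volume) (1 : ℝ))] with s hs1 hs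
  rw [uIoc_of_le zero_le_one] at hs
  have hs1 : s < 1 := lt_of_le_of_ne hs.2 hs1
  rw [Complex.ofReal_pow, ← Complex.mul_conj', Finset.sum_mul]
  refine Finset.sum_congr rfl fun l hl => ?_
  rw [← Finset.mul_sum, map_sum]
  congr 1
  have hlp := Finset.mem_range.mp hl
  symm
  -- For fixed `l`, substitute `m = l + k`; the values of `k` not reached contribute zero by the
  -- support of `h`.
  refine Finset.sum_of_injOn (fun m : ℕ => (m : ℤ) - l) (fun m _ m' _ h => ?_) (fun m hm => ?_)
    (fun k hk hkm => ?_) (fun m _ => ?_)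
  · simpa using h
  · have := Finset.mem_range.mp (Finset.mem_coe.mp hm)
    simp only [Finset.coe_Icc, mem_Icc]
    omega
  · rw [h0, map_zero]
    rintro ⟨h1, h2⟩
    have h3 : (-1 : ℝ) < ((l + k : ℤ) : ℝ) := by push_cast; linarith
    have h4 : ((l + k : ℤ) : ℝ) < ((p : ℤ) : ℝ) := by push_cast; linarith [hs.1]
    have h3 : -1 < (l + k : ℤ) := by exact_mod_cast h3
    have h4 := Int.cast_lt.mp h4
    refine hkm ⟨(l + k).toNat, ?_, ?_⟩
    · simp only [Finset.coe_range, mem_Iio]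
      omega
    · change (((l + k : ℤ).toNat : ℕ) : ℤ) - l = k
      omega
  · congr 2
    push_cast
    ring

theorem integral_eq_zero_of_sum_autocorrelation_eq_zero {h : ℝ → ℂ} (hm : Measurable h)
    (hi : Integrable h) {C : ℝ} (hC : ∀ t, ‖h t‖ ≤ C) {p : ℕ}
    (h0 : ∀ t ∉ Icc (0 : ℝ) p, h t = 0)
    (hz : ∑ k ∈ Finset.Icc (-p : ℤ) p, ∫ s, h s * starRingEnd ℂ (h (s + k)) = 0) :
    ∫ t, h t = 0 := by
  rw [sum_autocorrelation_eq hm hi hC h0, Complex.ofReal_eq_zero,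
    intervalIntegral.integral_of_le zero_le_one, integral_eq_zero_iff_of_nonneg] at hz
  · rw [integral_eq_integral_periodization hi h0, intervalIntegral.integral_of_le zero_le_one]
    refine integral_eq_zero_of_ae ?_
    filter_upwards [hz] with s hs
    simpa using hs
  · exact fun s => by positivity
  · have hmeas : Measurable fun s => ∑ l ∈ Finset.range p, h (s + l) :=
      Finset.measurable_fun_sum _ fun l _ => hm.comp (measurable_id.add_const (l : ℝ))
    refine Measure.integrableOn_of_bounded (M := (∑ _l ∈ Finset.range p, C) ^ 2) (by simp)
      (hmeas.norm.pow_const 2).aestronglyMeasurable (Filter.Eventually.of_forall fun s => ?_)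
    rw [Real.norm_of_nonneg (by positivity)]
    gcongr
    exact norm_sum_le_of_le _ fun l _ => hC _

/-! ### Nonvanishing for symmetric vectors -/

theorem phiStar_append_map_neg_ne_zero {A : List ℝ} (hA : A ≠ []) {ξ : ℝ}
    (hF : fourierTransform (tbSplineList A) ξ ≠ 0) :
    phiStar (tbSplineList (A ++ A.map fun l => -l)) ξ ≠ 0 := by
  obtain ⟨c, hc, hneg⟩ := tbSplineList_map_neg A
  obtain ⟨C, hC⟩ := tbSplineList_bdd A
  set f := tbSplineList A with hf
  set p := A.length with hp
  set φ := tbSplineList (A ++ A.map fun l => -l) with hφ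
  -- Reflecting the second factor turns the convolution into a correlation, centred at the midpoint
  -- `p` of the support `[0, 2p]`.
  have hcorr : ∀ k : ℤ, φ (p - k) = c * ∫ s, f s * f (s + k) := by
    intro k
    rw [hφ, tbSplineList_append hA (by simpa using hA), ← integral_const_mul]
    have hne : ∀ x : ℝ, ∀ᵐ s : ℝ, s ≠ x := fun x =>
      compl_mem_ae_iff.mpr (measure_singleton x)
    refine integral_congr_ae ?_
    filter_upwards [hne (p - k), hne (-k)] with s h1 h2
    rw [hneg _ (fun h => h1 (by linarith)) (fun h => h2 (by linarith))]
    rw [show (p : ℝ) - (p - k - s) = s + k by ring]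
    ring
  let h : ℝ → ℂ := fun t => (f t : ℂ) * Complex.exp (-(Complex.I * ξ * t))
  have hm : Measurable h :=
    (Complex.measurable_ofReal.comp (tbSplineList_measurable A)).mul
      (Continuous.measurable (by fun_prop))
  have hhC : ∀ t, ‖h t‖ ≤ C := fun t => by
    simpa [h, Complex.norm_exp] using hC t
  have h0 : ∀ t ∉ Icc (0 : ℝ) p, h t = 0 := fun t ht => by
    simp [h, hf, tbSplineList_eq_zero A ht]
  have hterm : ∀ k : ℤ, (φ (p - k) : ℂ) * Complex.exp (-(Complex.I * ξ * (p - k)))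
      = c * Complex.exp (-(Complex.I * ξ * p)) * ∫ s, h s * starRingEnd ℂ (h (s + k)) := by
    intro k
    rw [hcorr, Complex.ofReal_mul, ← integral_complex_ofReal, mul_assoc (c : ℂ), mul_assoc (c : ℂ),
      ← integral_mul_const, ← integral_const_mul (Complex.exp (-(Complex.I * ξ * p)))]
    congr 1
    refine integral_congr_ae (Filter.Eventually.of_forall fun s => ?_)
    have he : Complex.exp (-(Complex.I * ξ * (p - k))) = Complex.exp (-(Complex.I * ξ * p)) *
        (Complex.exp (-(Complex.I * ξ * s)) *
          Complex.exp (Complex.I * ξ * (s + k : ℝ))) := by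
      rw [← Complex.exp_add, ← Complex.exp_add]
      congr 1
      push_cast
      ring
    have hconj : starRingEnd ℂ (Complex.exp (-(Complex.I * ξ * (s + k : ℝ))))
        = Complex.exp (Complex.I * ξ * (s + k : ℝ)) := by
      rw [← Complex.exp_conj]
      simp
    simp only [h, map_mul, Complex.conj_ofReal, hconj, he]
    push_cast
    ring
  have hsum : phiStar φ ξ = c * Complex.exp (-(Complex.I * ξ * p)) *
      ∑ k ∈ Finset.Icc (-p : ℤ) p, ∫ s, h s * starRingEnd ℂ (h (s + k)) := by
    unfold phiStar
    rw [← (Equiv.subLeft (p : ℤ)).tsum_eq, Finset.mul_sum]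
    simp only [Equiv.subLeft_apply, Int.cast_sub, Int.cast_natCast]
    rw [tsum_eq_sum (s := Finset.Icc (-p : ℤ) p)]
    · exact Finset.sum_congr rfl fun k _ => hterm k
    · intro k hk
      rw [hφ, tbSplineList_eq_zero, Complex.ofReal_zero, zero_mul]
      simp only [List.length_append, List.length_map, Nat.cast_add, ← hp]
      rintro ⟨h1, h2⟩
      have h3 : ((k : ℤ) : ℝ) ≤ ((p : ℤ) : ℝ) := by push_cast; linarith
      have h4 : ((-p : ℤ) : ℝ) ≤ (k : ℝ) := by push_cast; linarith
      exact hk (Finset.mem_Icc.mpr ⟨Int.cast_le.mp h4, Int.cast_le.mp h3⟩)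
  rw [hsum]
  refine mul_ne_zero (mul_ne_zero (by exact_mod_cast hc.ne') (Complex.exp_ne_zero _)) fun hz => ?_
  exact hF (integral_eq_zero_of_sum_autocorrelation_eq_zero hm
    (fourierTransform_integrable (tbSplineList_integrable A) ξ) hhC h0 hz)

/-- The case `e^{-iξ} = 1` is treated apart because a zero entry makes the Fourier transform of the
half spline vanish at nonzero multiples of `2π`. -/
theorem IsSymmetric.phiStar_ne_zero {Λ : Multiset ℝ} (h : IsSymmetric Λ) {p : ℕ} (hp : 1 ≤ p)
    (hcard : Multiset.card Λ = 2 * p) (ξ : ℝ) : phiStar (tbSpline Λ) ξ ≠ 0 := by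
  by_cases hξ : Complex.exp (-(Complex.I * ξ)) = 1
  · exact phiStar_ne_zero_of_exp_eq_one (by omega) hξ
  · obtain ⟨A, hA, rfl⟩ := h.exists_eq_add hcard
    have hF := fourierTransform_tbSpline_ne_zero (Λ := A) (by omega) hξ
    induction A using Quot.inductionOn with
    | h L =>
      refine phiStar_append_map_neg_ne_zero (A := L) ?_ hF
      rintro rfl
      change 0 = p at hA
      omega

end ExpSpline

theorem mainTheorem5 :
    (∀ (N : ℕ) (Λ : Multiset ℝ), 1 ≤ N → Multiset.card Λ = N →
      (∀ ξ : ℝ,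
        Summable (fun j : ℤ =>
          (ExpSpline.tbSpline Λ j : ℂ) * Complex.exp (-(Complex.I * ξ * j))) ∧
        Summable (fun j : ℤ =>
          Complex.exp (Complex.I * ξ) ^ j * (ExpSpline.tbSpline Λ (0 - j) : ℂ)) ∧
        ExpSpline.phiStar (ExpSpline.tbSpline Λ) ξ
          = ExpSpline.eulerSchoenberg Λ 0 (Complex.exp (Complex.I * ξ))) ∧
      ((∀ ξ : ℝ, ExpSpline.phiStar (ExpSpline.tbSpline Λ) ξ ≠ 0) ↔
        ∀ z : ℂ, ‖z‖ = 1 → ExpSpline.eulerSchoenberg Λ 0 z ≠ 0)) ∧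
    (∀ (p : ℕ) (Λ : Multiset ℝ), 1 ≤ p → Multiset.card Λ = 2 * p → ExpSpline.IsSymmetric Λ →
      ∀ ξ : ℝ, ExpSpline.phiStar (ExpSpline.tbSpline Λ) ξ ≠ 0) := by
  refine ⟨fun N Λ _ _ => ⟨fun ξ => ⟨?_, ?_⟩, ?_⟩, fun p Λ hp hcard h ξ => ?_⟩
  · exact ExpSpline.phiStar_tbSpline_summable Λ _
  · exact ExpSpline.phiStar_eq_eulerSchoenberg Λ ξ
  · exact ExpSpline.phiStar_ne_zero_iff Λ
  · exact h.phiStar_ne_zero hp hcard ξ
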